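/- Consider a network with $N$ sub-channels and users $1,\dots,L$ ($L\ge 1$), where user $1$ is the primary user (PU) and $\Omega=\{2,\dots,L\}$ is the set of secondary users (SUs). Let $h_{i,j}^f\in\mathbb{C}$ be the channel coefficient from the transmitter of user $i$ to the receiver of user $j$ on sub-channel $f$, $N_j^f>0$ the noise variance at user $j$ on sub-channel $f$, and $P_j^{\max}\ge 0$ the (finite) power budget of user $j$. For each user $j$ let $$\mathcal{S}_j=\Big\{\mathbf{P}_j=(P_j^1,\dots,P_j^N)\in\mathbb{R}^N:\ \sum_{f=1}^N P_j^f\le P_j^{\max},\ P_j^f\ge 0 \text{ for all } f\Big\}.$$ Fix a PU power allocation $\mathbf{P}_1\in\mathcal{S}_1$. Let $\mathcal{G}=\{\Omega,\{\mathcal{S}_i\}_{i\in\Omega},\{u_i\}_{i\in\Omega}\}$ be the non-cooperative game with players $i\in\Omega$, strategy sets $\mathcal{S}_i$, and utilities $$u_i(\mathbf{P}_i,\mathbf{P}_{-i})=\sum_{f=1}^N\log\left(1+\frac{P_i^f|h_{i,i}^f|^2}{\sum_{k\in\{1,\dots,L\},\,k\ne i}P_k^f|h_{k,i}^f|^2+N_i^f}\right),\qquad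 \mathbf{P}_{-i}=\{\mathbf{P}_k\}_{k\in\Omega\setminus\{i\}}.$$ Then for every $i\in\Omega$ the set $\mathcal{S}_i$ is compact and convex, $u_i$ is continuous on $\prod_{k\in\Omega}\mathcal{S}_k$, and for all $\mathbf{P}_{-i}\in\prod_{k\in\Omega\setminus\{i\}}\mathcal{S}_k$ the function $\mathbf{P}_i\mapsto u_i(\mathbf{P}_i,\mathbf{P}_{-i})$ is quasi-concave on $\mathcal{S}_i$. Moreover, $\mathcal{G}$ has at least one pure-strategy Nash equilibrium, that is, there is $(\mathbf{P}_i^*)_{i\in\Omega}\in\prod_{i\in\Omega}\mathcal{S}_i$ such that $u_i(\mathbf{P}_i^*,\mathbf{P}_{-i}^*)\ge u_i(\mathbf{P}_i,\mathbf{P}_{-i}^*)$ for all $i\in\Omega$ and all $\mathbf{P}_i\in\mathcal{S}_i$. -/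

import Mathlib

/-- A game in strategic form with player set `ι`, in which every player picks a point of `X`. -/
structure StrategicGame (ι X : Type*) where
  /-- the admissible (pure) strategies of each player -/
  strategies : ι → Set X
  /-- the utility of each player at a strategy profile -/
  utility : ι → (ι → X) → ℝ

/-- `P` is a pure-strategy Nash equilibrium: it is an admissible profile, and no player can gain
by a unilateral deviation to another of its admissible strategies. -/
def StrategicGame.IsPureNash {ι X : Type*} [DecidableEq ι] (G : StrategicGame ι X)
    (P : ι → X) : Prop :=
  (∀ i, P i ∈ G.strategies i) ∧
    ∀ i, ∀ p ∈ G.strategies i, G.utility i (Function.update P i p) ≤ G.utility i P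

/-- An OFDM cognitive radio network with `N` sub-channels, one primary user (user `0`) and `K`
secondary users (the users `i.succ` with `i : Fin K`). -/
structure CRNetwork (K N : ℕ) where
  /-- `h i j f`: channel coefficient from the transmitter of user `i` to the receiver of user `j`
  on sub-channel `f` -/
  h : Fin (K + 1) → Fin (K + 1) → Fin N → ℂ
  /-- `noise j f`: variance of the noise at user `j` on sub-channel `f` -/
  noise : Fin (K + 1) → Fin N → ℝ
  noise_pos : ∀ j f, 0 < noise j f
  /-- `Pmax j`: power budget of user `j` -/
  Pmax : Fin (K + 1) → ℝ
  Pmax_nonneg : ∀ j, 0 ≤ Pmax j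

namespace CRNetwork

variable {K N : ℕ} (C : CRNetwork K N)

/-- The power allocations over the sub-channels that are admissible for user `j`. -/
def powerSet (j : Fin (K + 1)) : Set (Fin N → ℝ) :=
  {p | (∀ f, 0 ≤ p f) ∧ ∑ f, p f ≤ C.Pmax j}

/-- The maximum rate (in nats/s/Hz) of user `j` on sub-channel `f` when the users transmit with
the powers `P`, interference being treated as noise. -/
noncomputable def rate (P : Fin (K + 1) → Fin N → ℝ) (j : Fin (K + 1)) (f : Fin N) : ℝ :=
  Real.log (1 + P j f * ‖C.h j j f‖ ^ 2 /
    (∑ i ∈ Finset.univ.erase j, P i f * ‖C.h i j f‖ ^ 2 + C.noise j f))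

/-- The power allocation sub-game of the secondary users when the power allocation of the primary
user is fixed to `P₁`: the utility of a secondary user is its total rate. -/
noncomputable def subGame (P₁ : Fin N → ℝ) : StrategicGame (Fin K) (Fin N → ℝ) where
  strategies i := C.powerSet i.succ
  utility i P := ∑ f, C.rate (Fin.cons P₁ P : Fin (K + 1) → Fin N → ℝ) i.succ f

end CRNetwork

open Set Metric MeasureTheory Polynomial
open scoped NNReal

/-! With the other users fixed, each rate is the logarithm of a positive affine function of the
user's own power. Utilities are therefore concave in the own strategy, and an equilibrium is a point
where no player's own gradient points into its strategy set. Stacking these gradients into one field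
turns this into a variational inequality on the compact convex product of strategy sets
(`IsCompact.exists_variational_inequality`), solved by a Brouwer fixed point of a projected gradient
step. Brouwer's theorem is proved analytically: the integral of `det (id + t g')` over a ball is
polynomial in `t` and equals the volume for small `t`, hence also at `t = 1`; a `C¹` retraction onto
the sphere would make it zero there. -/

/-! ### Volume under Lipschitz perturbations of the identity -/

/-- `det (id + t A)` is a polynomial in `t` of degree at most the dimension, so its values at small
nodes determine its value at `t = 1`. -/
theorem ContinuousLinearMap.det_id_add_eq_sum_lagrange {E : Type*} [NormedAddCommGroup E]
    [NormedSpace ℝ E] [FiniteDimensional ℝ E] (A : E →L[ℝ] E) (s : Finset ℝ)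
    (hs : Module.finrank ℝ E < s.card) :
    (ContinuousLinearMap.id ℝ E + A).det =
      ∑ a ∈ s, (Lagrange.basis s id a).eval 1 * (ContinuousLinearMap.id ℝ E + a • A).det := by
  let b := Module.finBasis ℝ E
  let M := LinearMap.toMatrix b b (A : E →ₗ[ℝ] E)
  let p : ℝ[X] := Matrix.det ((X : ℝ[X]) • M.map C + (1 : Matrix _ _ ℝ).map C)
  have hp : ∀ t : ℝ, p.eval t = (ContinuousLinearMap.id ℝ E + t • A).det := by
    intro t
    have h1 : (ContinuousLinearMap.id ℝ E + t • A).det = (t • M + 1).det := by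
      rw [ContinuousLinearMap.det, ← LinearMap.det_toMatrix b, add_comm]
      congr 1
      simp [M]
    rw [h1, ← Polynomial.coe_evalRingHom, RingHom.map_det]
    congr 1
    ext i j
    by_cases hij : i = j <;> simp [hij] <;> ring
  have hdeg : p.degree < s.card := by
    refine lt_of_le_of_lt Polynomial.degree_le_natDegree ?_
    have := Polynomial.natDegree_det_X_add_C_le M 1
    rw [Fintype.card_fin] at this
    exact_mod_cast this.trans_lt hs
  have h := congrArg (Polynomial.eval 1)
    (Lagrange.eq_interpolate (s := s) (v := id) (Set.injOn_id _) hdeg)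
  rw [hp, one_smul, Lagrange.interpolate_apply, Polynomial.eval_finsetSum] at h
  rw [h]
  refine Finset.sum_congr rfl fun a _ => ?_
  rw [Polynomial.eval_mul, Polynomial.eval_C, id, hp, mul_comm]

/-- Along the path `id + t A`, `0 ≤ t ≤ 1`, the kernel stays trivial, so the determinant cannot
change sign from its value 1 at `t = 0`. -/
theorem ContinuousLinearMap.det_id_add_pos {E : Type*} [NormedAddCommGroup E]
    [NormedSpace ℝ E] [FiniteDimensional ℝ E] {A : E →L[ℝ] E} (hA : ‖A‖ < 1) :
    0 < (ContinuousLinearMap.id ℝ E + A).det := by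
  have hne : ∀ t ∈ Icc (0 : ℝ) 1, (ContinuousLinearMap.id ℝ E + t • A).det ≠ 0 := by
    intro t ht h0
    obtain ⟨x, hx, hx0⟩ : ∃ x : E, x ≠ 0 ∧ x + t • A x = 0 := by
      obtain ⟨x, hx, hx0⟩ := (Submodule.ne_bot_iff _).1 (LinearMap.bot_lt_ker_of_det_eq_zero h0).ne'
      exact ⟨x, hx0, by simpa using hx⟩
    have h1 : ‖x‖ = t * ‖A x‖ := by
      rw [eq_neg_of_add_eq_zero_left hx0, norm_neg, norm_smul, Real.norm_of_nonneg ht.1,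
        ← eq_neg_of_add_eq_zero_left hx0]
    have h2 := A.le_opNorm x
    have h3 : 0 < ‖x‖ := norm_pos_iff.2 hx
    nlinarith [ht.1, ht.2, norm_nonneg (A x)]
  have hc : Continuous fun t : ℝ => (ContinuousLinearMap.id ℝ E + t • A).det :=
    ContinuousLinearMap.continuous_det.comp (by fun_prop)
  by_contra! hle
  obtain ⟨t, ht, h0⟩ := intermediate_value_Icc' zero_le_one hc.continuousOn
    (show (0 : ℝ) ∈ Icc _ _ by simpa [ContinuousLinearMap.det] using hle)
  exact hne t ht h0

/-- A perturbation of the identity with Lipschitz constant below 1 is a bijection of `E`; being the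
identity off the ball, it must preserve the ball. -/
theorem image_ball_add_smul_of_lipschitzWith {E : Type*} [NormedAddCommGroup E]
    [NormedSpace ℝ E] [CompleteSpace E] {g : E → E} {c : ℝ≥0} {R : ℝ} (hg : LipschitzWith c g)
    (hg0 : ∀ x ∉ ball (0 : E) R, g x = 0) {t : ℝ} (ht0 : 0 ≤ t) (ht : t * c < 1) :
    Function.Injective (fun x => x + t • g x) ∧
      (fun x => x + t • g x) '' ball 0 R = ball 0 R := by
  have happ : ApproximatesLinearOn (fun x => x + t • g x)
      ((ContinuousLinearEquiv.refl ℝ E : E ≃L[ℝ] E) : E →L[ℝ] E) univ (t.toNNReal * c) := by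
    intro x _ y _
    have : x + t • g x - (y + t • g y) - (x - y) = t • (g x - g y) := by
      rw [smul_sub]; abel
    simp only [ContinuousLinearEquiv.coe_refl, ContinuousLinearMap.coe_id', id, this, norm_smul,
      Real.norm_of_nonneg ht0, NNReal.coe_mul, Real.coe_toNNReal _ ht0, mul_assoc]
    gcongr
    simpa [dist_eq_norm] using hg.dist_le_mul x y
  have hinv : Subsingleton E ∨ t.toNNReal * c <
      ‖((ContinuousLinearEquiv.refl ℝ E).symm : E →L[ℝ] E)‖₊⁻¹ := by
    rcases subsingleton_or_nontrivial E with h | h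
    · exact Or.inl h
    · refine Or.inr ?_
      have : ‖((ContinuousLinearEquiv.refl ℝ E).symm : E →L[ℝ] E)‖₊ = 1 := by
        simp
      rw [this, inv_one, ← NNReal.coe_lt_coe]
      simpa [ht0] using ht
  have hinj : Function.Injective (fun x => x + t • g x) :=
    injOn_univ.1 (happ.injOn hinv)
  have hsurj : Function.Surjective (fun x => x + t • g x) := happ.surjective hinv
  have hfix : ∀ x ∉ ball (0 : E) R, x + t • g x = x := fun x hx => by simp [hg0 x hx]
  refine ⟨hinj, Subset.antisymm ?_ ?_⟩
  · rintro _ ⟨x, hx, rfl⟩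
    by_contra hn
    have h1 := hinj (hfix _ hn)
    exact hn (h1.symm ▸ hx)
  · intro y hy
    obtain ⟨x, rfl⟩ := hsurj y
    refine ⟨x, ?_, rfl⟩
    by_contra hn
    exact hn (by simpa [hg0 x hn] using hy)

/-- Change of variables gives the formula with `t • g` for small `t`; Lagrange interpolation carries
it to `t = 1`, where injectivity may fail. -/
theorem setIntegral_det_id_add_fderiv {E : Type*} [NormedAddCommGroup E]
    [NormedSpace ℝ E] [FiniteDimensional ℝ E] [MeasurableSpace E] [BorelSpace E]
    (μ : Measure E) [μ.IsAddHaarMeasure] {g : E → E} {c : ℝ≥0} {R : ℝ}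
    (hg : LipschitzWith c g) (hg0 : ∀ x ∉ ball (0 : E) R, g x = 0)
    (hg1 : DifferentiableOn ℝ g (ball 0 R)) :
    ∫ x in ball 0 R, (ContinuousLinearMap.id ℝ E + fderiv ℝ g x).det ∂μ = μ.real (ball 0 R) := by
  have hbound : ∀ x, ‖fderiv ℝ g x‖ ≤ c := fun x => norm_fderiv_le_of_lipschitz ℝ hg
  have hdetc (t : ℝ) : Continuous fun A : E →L[ℝ] E => (ContinuousLinearMap.id ℝ E + t • A).det :=
    ContinuousLinearMap.continuous_det.comp (by fun_prop)
  have hint (t : ℝ) : IntegrableOn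
      (fun x => (ContinuousLinearMap.id ℝ E + t • fderiv ℝ g x).det) (ball 0 R) μ := by
    obtain ⟨B, hB⟩ := (isCompact_closedBall (0 : E →L[ℝ] E) c).exists_bound_of_continuousOn
      (hdetc t).continuousOn
    refine Measure.integrableOn_of_bounded (M := B) measure_ball_lt_top.ne
      ((hdetc t).measurable.comp (measurable_fderiv ℝ g)).aestronglyMeasurable ?_
    exact Filter.Eventually.of_forall fun x => hB _ (by simpa using hbound x)
  have hsmall : ∀ t : ℝ, 0 ≤ t → t * c < 1 →
      ∫ x in ball 0 R, (ContinuousLinearMap.id ℝ E + t • fderiv ℝ g x).det ∂μ =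
        μ.real (ball 0 R) := by
    intro t ht0 ht
    obtain ⟨hinj, himg⟩ := image_ball_add_smul_of_lipschitzWith hg hg0 ht0 ht
    have hder : ∀ x ∈ ball (0 : E) R, HasFDerivWithinAt (fun x => x + t • g x)
        (ContinuousLinearMap.id ℝ E + t • fderiv ℝ g x) (ball 0 R) x := by
      intro x hx
      have hd : DifferentiableAt ℝ g x :=
        (hg1 x hx).differentiableAt (isOpen_ball.mem_nhds hx)
      exact ((hasFDerivAt_id x).add (hd.hasFDerivAt.const_smul t)).hasFDerivWithinAt
    have h := integral_image_eq_integral_abs_det_fderiv_smul μ measurableSet_ball hder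
      hinj.injOn (fun _ => (1 : ℝ))
    rw [himg] at h
    simp only [smul_eq_mul, mul_one, integral_const, measureReal_restrict_apply_univ] at h
    rw [h]
    refine setIntegral_congr_fun measurableSet_ball fun x _ => (abs_of_pos ?_).symm
    refine ContinuousLinearMap.det_id_add_pos ?_
    rw [norm_smul, Real.norm_of_nonneg ht0]
    exact (mul_le_mul_of_nonneg_left (hbound x) ht0).trans_lt ht
  -- Nodes below `1 / (c + 1)` satisfy `a * c < 1`, also when `c = 0`.
  obtain ⟨s, hsub, hcard⟩ := (Ioo_infinite (show (0 : ℝ) < 1 / (c + 1) by positivity)).exists_subset_card_eq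
    (Module.finrank ℝ E + 1)
  have hs : ∀ a ∈ s, 0 ≤ a ∧ a * c < 1 := by
    intro a ha
    obtain ⟨h1, h2⟩ := hsub ha
    rw [lt_div_iff₀ (by positivity)] at h2
    exact ⟨h1.le, by nlinarith⟩
  have hsum : ∑ a ∈ s, (Lagrange.basis s id a).eval (1 : ℝ) = 1 := by
    rw [← Polynomial.eval_finsetSum, Lagrange.sum_basis (Set.injOn_id _)
      (Finset.card_pos.1 (by omega)), Polynomial.eval_one]
  calc ∫ x in ball 0 R, (ContinuousLinearMap.id ℝ E + fderiv ℝ g x).det ∂μ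
      = ∫ x in ball 0 R, ∑ a ∈ s, (Lagrange.basis s id a).eval 1 *
          (ContinuousLinearMap.id ℝ E + a • fderiv ℝ g x).det ∂μ := by
        refine integral_congr_ae (Filter.Eventually.of_forall fun x => ?_)
        exact ContinuousLinearMap.det_id_add_eq_sum_lagrange _ s (by omega)
    _ = ∑ a ∈ s, (Lagrange.basis s id a).eval 1 * μ.real (ball 0 R) := by
        rw [integral_finsetSum _ fun a _ => (hint a).const_mul _]
        refine Finset.sum_congr rfl fun a ha => ?_
        rw [integral_const_mul, hsmall a (hs a ha).1 (hs a ha).2]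
    _ = μ.real (ball 0 R) := by rw [← Finset.sum_mul, hsum, one_mul]

/-! ### Non-retraction and Brouwer's theorem -/

/-- A segment leaving the ball meets the sphere, where `f` vanishes, so extension by zero keeps the
constant. -/
theorem LipschitzOnWith.lipschitzWith_indicator_ball {E F : Type*} [NormedAddCommGroup E]
    [NormedSpace ℝ E] [NormedAddCommGroup F] {f : E → F} {c : ℝ≥0} {R : ℝ}
    (hf : LipschitzOnWith c f (closedBall 0 R)) (h0 : ∀ x ∈ sphere (0 : E) R, f x = 0) :
    LipschitzWith c ((ball (0 : E) R).indicator f) := by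
  have key : ∀ x ∈ ball (0 : E) R, ∀ y ∉ ball (0 : E) R, ‖f x‖ ≤ c * dist x y := by
    intro x hx y hy
    obtain ⟨z, hz, hzR⟩ := (convex_segment x y).isPreconnected.intermediate_value
      (left_mem_segment ℝ x y) (right_mem_segment ℝ x y) (continuous_norm.continuousOn)
      (show R ∈ Icc ‖x‖ ‖y‖ from ⟨(mem_ball_zero_iff.1 hx).le, by simpa using hy⟩)
    have h1 := hf.dist_le_mul x (ball_subset_closedBall hx) z (by simpa using hzR.le)
    rw [h0 z (by simpa using hzR), dist_zero_right] at h1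
    refine h1.trans ?_
    have := dist_add_dist_of_mem_segment hz
    gcongr
    linarith [dist_nonneg (x := z) (y := y)]
  refine LipschitzWith.of_dist_le_mul fun x y => ?_
  by_cases hx : x ∈ ball (0 : E) R <;> by_cases hy : y ∈ ball (0 : E) R
  · simpa [hx, hy] using hf.dist_le_mul x (ball_subset_closedBall hx) y (ball_subset_closedBall hy)
  · rw [indicator_of_mem hx, indicator_of_notMem hy, dist_zero_right]
    exact key x hx y hy
  · rw [indicator_of_mem hy, indicator_of_notMem hx, dist_zero_left, dist_comm]
    exact key y hy x hx
  · rw [indicator_of_notMem hx, indicator_of_notMem hy, dist_self]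
    positivity

/-- There is no `C¹` retraction of a closed ball onto its boundary sphere. -/
theorem not_contDiffAt_retraction_sphere {E : Type*} [NormedAddCommGroup E]
    [InnerProductSpace ℝ E] [FiniteDimensional ℝ E] {R : ℝ} (hR : 0 < R) {r : E → E}
    (hr : ∀ x ∈ closedBall (0 : E) R, ContDiffAt ℝ 1 r x)
    (hrR : ∀ x ∈ closedBall (0 : E) R, ‖r x‖ = R) (hfix : ∀ x ∈ sphere (0 : E) R, r x = x) :
    False := by
  borelize E
  let μ : Measure E := Measure.addHaar
  let g : E → E := (ball (0 : E) R).indicator (fun x => r x - x)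
  have hd : ∀ x ∈ closedBall (0 : E) R, ContDiffAt ℝ 1 (fun x => r x - x) x :=
    fun x hx => (hr x hx).sub contDiffAt_id
  obtain ⟨c, hc⟩ : ∃ c, LipschitzOnWith c (fun x => r x - x) (closedBall 0 R) := by
    refine LocallyLipschitzOn.exists_lipschitzOnWith_of_compact (isCompact_closedBall 0 R) ?_
    intro x hx
    obtain ⟨K, t, ht, hK⟩ := (hd x hx).exists_lipschitzOnWith
    exact ⟨K, t, mem_nhdsWithin_of_mem_nhds ht, hK⟩
  have hg : LipschitzWith c g :=
    hc.lipschitzWith_indicator_ball fun x hx => by rw [hfix x hx, sub_self]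
  have heq : EqOn g (fun x => r x - x) (ball 0 R) := fun x hx => indicator_of_mem hx _
  have hg1 : DifferentiableOn ℝ g (ball 0 R) :=
    DifferentiableOn.congr (fun x hx => ((hd x (ball_subset_closedBall hx)).differentiableAt
      one_ne_zero).differentiableWithinAt) heq
  have h := setIntegral_det_id_add_fderiv μ hg (fun x hx => indicator_of_notMem hx _) hg1
  have hz : ∀ x ∈ ball (0 : E) R, (ContinuousLinearMap.id ℝ E + fderiv ℝ g x).det = 0 := by
    intro x hx
    have hnhds := isOpen_ball.mem_nhds hx
    have hrd : DifferentiableAt ℝ r x :=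
      (hr x (ball_subset_closedBall hx)).differentiableAt one_ne_zero
    have h1 : ContinuousLinearMap.id ℝ E + fderiv ℝ g x = fderiv ℝ r x := by
      rw [(heq.eventuallyEq_of_mem hnhds).fderiv_eq, fderiv_fun_sub hrd differentiableAt_fun_id,
        fderiv_fun_id]
      abel
    rw [h1]
    -- Since `‖r‖` is constant, the range of the derivative is orthogonal to `r x ≠ 0`; it is not
    -- surjective and its determinant vanishes.
    have h2 : ∀ v, inner ℝ (r x) (fderiv ℝ r x v) = 0 := by
      intro v
      have h3 := (hrd.hasFDerivAt.inner ℝ hrd.hasFDerivAt)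
      have h4 : HasFDerivAt (fun y => inner ℝ (r y) (r y)) (0 : E →L[ℝ] ℝ) x := by
        refine (hasFDerivAt_const (R ^ 2) x).congr_of_eventuallyEq ?_
        filter_upwards [hnhds] with y hy
        rw [real_inner_self_eq_norm_sq, hrR y (ball_subset_closedBall hy)]
      have h5 := congrArg (fun L : E →L[ℝ] ℝ => L v) (h3.unique h4)
      simp [fderivInnerCLM_apply, real_inner_comm] at h5
      exact h5
    by_contra hdet
    have hu : IsUnit (fderiv ℝ r x : E →ₗ[ℝ] E) := by
      rw [LinearMap.isUnit_iff_isUnit_det]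
      exact isUnit_iff_ne_zero.2 hdet
    obtain ⟨v, hv⟩ := ((Module.End.isUnit_iff _).1 hu).2 (r x)
    have h6 := h2 v
    rw [show fderiv ℝ r x v = r x from hv, real_inner_self_eq_norm_sq,
      hrR x (ball_subset_closedBall hx)] at h6
    exact (pow_pos hR 2).ne' h6
  rw [setIntegral_congr_fun measurableSet_ball hz, integral_zero] at h
  exact (ENNReal.toReal_pos (measure_ball_pos μ (0 : E) hR).ne' measure_ball_lt_top.ne).ne h
-- Without a fixed point, pushing `x` away from `P x` until it hits the sphere would be a `C¹`
-- retraction.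
theorem exists_fixedPoint_of_contDiff {E : Type*} [NormedAddCommGroup E]
    [InnerProductSpace ℝ E] [FiniteDimensional ℝ E] {R : ℝ} (hR : 0 < R) {P : E → E}
    (hP : ContDiff ℝ 1 P) (hPR : ∀ x ∈ closedBall (0 : E) R, ‖P x‖ < R) :
    ∃ x ∈ closedBall (0 : E) R, P x = x := by
  by_contra! hne
  let u : E → E := fun x => x - P x
  let a : E → ℝ := fun x => ‖u x‖ ^ 2
  let b : E → ℝ := fun x => inner ℝ x (u x)
  let d : E → ℝ := fun x => b x ^ 2 + a x * (R ^ 2 - ‖x‖ ^ 2)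
  -- The larger root of `‖x + s u‖² = R²`. The strict bound on `P` keeps `d` positive up to the
  -- boundary, so the square root is `C¹`.
  let s : E → ℝ := fun x => (-b x + √(d x)) / a x
  have hu : ContDiff ℝ 1 u := contDiff_id.sub hP
  have ha : ContDiff ℝ 1 a := hu.norm_sq ℝ
  have hb : ContDiff ℝ 1 b := contDiff_id.inner ℝ hu
  have hd : ContDiff ℝ 1 d :=
    (hb.pow 2).add (ha.mul (contDiff_const.sub (contDiff_id.norm_sq ℝ)))
  have hapos : ∀ x ∈ closedBall (0 : E) R, 0 < a x := fun x hx =>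
    pow_pos (norm_pos_iff.2 (sub_ne_zero.2 (hne x hx).symm)) 2
  have hbpos : ∀ x ∈ closedBall (0 : E) R, ‖x‖ = R → 0 < b x := by
    intro x hx hxR
    have h1 := real_inner_le_norm x (P x)
    have h2 : b x = R ^ 2 - inner ℝ x (P x) := by
      simp only [b, u, inner_sub_right, real_inner_self_eq_norm_sq, hxR]
    rw [hxR] at h1
    nlinarith [hPR x hx]
  have hdpos : ∀ x ∈ closedBall (0 : E) R, 0 < d x := by
    intro x hx
    have hle : ‖x‖ ≤ R := mem_closedBall_zero_iff.1 hx
    rcases hle.lt_or_eq with h | h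
    · have : 0 < R ^ 2 - ‖x‖ ^ 2 := by nlinarith [norm_nonneg x]
      have := mul_pos (hapos x hx) this
      positivity
    · have := hbpos x hx h
      simp only [d, h, sub_self, mul_zero, add_zero]
      positivity
  refine not_contDiffAt_retraction_sphere hR (r := fun x => x + s x • u x) ?_ ?_ ?_
  · intro x hx
    have hs : ContDiffAt ℝ 1 s x :=
      (hb.contDiffAt.neg.add (hd.contDiffAt.sqrt (hdpos x hx).ne')).div ha.contDiffAt
        (hapos x hx).ne'
    exact contDiffAt_id.add (hs.smul hu.contDiffAt)
  · intro x hx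
    have h1 : ‖x + s x • u x‖ ^ 2 = ‖x‖ ^ 2 + 2 * (s x * b x) + s x ^ 2 * a x := by
      rw [norm_add_sq_real, inner_smul_right, norm_smul, mul_pow, Real.norm_eq_abs, sq_abs]
    have h2 : s x * a x = -b x + √(d x) := div_mul_cancel₀ _ (hapos x hx).ne'
    have h3 : √(d x) ^ 2 = b x ^ 2 + a x * (R ^ 2 - ‖x‖ ^ 2) := Real.sq_sqrt (hdpos x hx).le
    have h4 : a x * ‖x + s x • u x‖ ^ 2 = a x * R ^ 2 := by
      rw [h1]
      have h5 : √(d x) = s x * a x + b x := by linarith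
      rw [h5] at h3
      linarith
    exact (pow_left_inj₀ (norm_nonneg _) hR.le two_ne_zero).1
      (mul_left_cancel₀ (hapos x hx).ne' h4)
  · intro x hx
    have hxR : ‖x‖ = R := mem_sphere_zero_iff_norm.1 hx
    have hb0 := hbpos x (sphere_subset_closedBall hx) hxR
    have : s x = 0 := by
      simp only [s, d, hxR, sub_self, mul_zero, add_zero, Real.sqrt_sq hb0.le, neg_add_cancel,
        zero_div]
    simp [this]

/-- **Brouwer fixed point theorem** for bounded continuous self-maps of a Euclidean space. -/
theorem Continuous.exists_fixedPoint_of_bounded {E : Type*} [NormedAddCommGroup E]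
    [InnerProductSpace ℝ E] [FiniteDimensional ℝ E] {G : E → E} (hG : Continuous G) {M : ℝ}
    (hM : ∀ x, ‖G x‖ ≤ M) : ∃ x, G x = x := by
  have hM0 : 0 ≤ M := (norm_nonneg _).trans (hM 0)
  by_contra! hne
  obtain ⟨x₀, -, hx₀⟩ := (isCompact_closedBall (0 : E) (M + 1)).exists_isMinOn
    ⟨0, by simpa using by linarith⟩ (hG.dist continuous_id).continuousOn
  -- The 1 keeps the approximation inside the ball of radius `M + 1`; the minimal displacement is
  -- what its fixed point contradicts.
  let ε := min 1 (dist (G x₀) x₀)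
  have hε : 0 < ε := lt_min one_pos (dist_pos.2 (hne x₀))
  obtain ⟨P, hP, hPG, -⟩ := hG.exists_contDiff_approx 1 (ε := fun _ => ε) continuous_const
    fun _ => hε
  obtain ⟨x, hx, hfix⟩ := exists_fixedPoint_of_contDiff (R := M + 1) (by linarith) hP
    fun x _ => by
      have h1 := hPG x
      rw [dist_eq_norm] at h1
      have h2 := norm_le_norm_add_norm_sub (G x) (P x)
      rw [norm_sub_rev] at h2
      linarith [hM x, min_le_left 1 (dist (G x₀) x₀)]
  have h1 := hPG x
  have h2 : dist (G x₀) x₀ ≤ dist (G x) x := hx₀ hx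
  rw [hfix, dist_comm] at h1
  linarith [min_le_right 1 (dist (G x₀) x₀)]

/-! ### Projections and variational inequalities -/

theorem Convex.exists_continuous_metric_projection {E : Type*} [NormedAddCommGroup E]
    [InnerProductSpace ℝ E] {S : Set E} (hne : S.Nonempty) (hS : IsComplete S)
    (hconv : Convex ℝ S) : ∃ p : E → E, Continuous p ∧ (∀ x, p x ∈ S) ∧
      ∀ x, ∀ y ∈ S, inner ℝ (x - p x) (y - p x) ≤ 0 := by
  choose p hpS hp using exists_norm_eq_iInf_of_complete_convex hne hS hconv
  have hp' : ∀ x, ∀ y ∈ S, inner ℝ (x - p x) (y - p x) ≤ 0 := fun x =>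
    (norm_eq_iInf_iff_real_inner_le_zero hconv (hpS x)).1 (hp x)
  refine ⟨p, ?_, hpS, hp'⟩
  refine (LipschitzWith.of_dist_le_mul (K := 1) fun x y => ?_).continuous
  rw [NNReal.coe_one, one_mul, dist_eq_norm, dist_eq_norm]
  have h1 := hp' x (p y) (hpS y)
  have h2 := hp' y (p x) (hpS x)
  -- Adding the two obtuse-angle inequalities and applying Cauchy–Schwarz shows that `p` is
  -- 1-Lipschitz.
  have h3 : inner ℝ (x - p x) (p y - p x) + inner ℝ (y - p y) (p x - p y) =
      ‖p x - p y‖ ^ 2 - inner ℝ (x - y) (p x - p y) := by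
    rw [← real_inner_self_eq_norm_sq, ← neg_sub (p x) (p y), inner_neg_right]
    simp only [inner_sub_left]
    ring
  have h4 := real_inner_le_norm (x - y) (p x - p y)
  by_contra! hlt
  nlinarith [norm_nonneg (x - y), norm_nonneg (p x - p y)]

/-- The Hartman–Stampacchia theorem: a variational inequality with continuous data on a compact
convex set has a solution. -/
theorem IsCompact.exists_variational_inequality {E : Type*} [NormedAddCommGroup E]
    [InnerProductSpace ℝ E] [FiniteDimensional ℝ E] {S : Set E} (hS : IsCompact S)
    (hconv : Convex ℝ S) (hne : S.Nonempty) {F : E → E} (hF : ContinuousOn F S) :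
    ∃ x ∈ S, ∀ y ∈ S, inner ℝ (F x) (y - x) ≤ 0 := by
  obtain ⟨p, hpc, hpS, hp⟩ := hconv.exists_continuous_metric_projection hne hS.isComplete
  obtain ⟨M, hM⟩ := hS.isBounded.exists_norm_le
  -- Precomposing with `p` makes the map continuous on all of `E`, although `F` is only continuous
  -- on `S`.
  obtain ⟨x, hx⟩ := Continuous.exists_fixedPoint_of_bounded
    (G := fun x => p (p x + F (p x)))
    (hpc.comp (hpc.add (hF.comp_continuous hpc hpS))) fun x => hM _ (hpS _)
  have hxS : x ∈ S := hx ▸ hpS _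
  have hpx : p x = x := by
    have h := hp x x hxS
    rw [real_inner_self_eq_norm_sq] at h
    have h0 : ‖x - p x‖ = 0 := by
      nlinarith [norm_nonneg (x - p x)]
    exact (sub_eq_zero.1 (norm_eq_zero.1 h0)).symm
  refine ⟨x, hxS, fun y hy => ?_⟩
  have h := hp (x + F x) y hy
  simp only [hpx] at hx
  rwa [hx, add_sub_cancel_left] at h
-- The power allocation game
namespace CRNetwork

variable {K N : ℕ} (C : CRNetwork K N)

/-- The interference plus noise received by user `j` on sub-channel `f`. -/
noncomputable def interference (P : Fin (K + 1) → Fin N → ℝ) (j : Fin (K + 1)) (f : Fin N) : ℝ :=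
  ∑ i ∈ Finset.univ.erase j, P i f * ‖C.h i j f‖ ^ 2 + C.noise j f

theorem rate_eq (P : Fin (K + 1) → Fin N → ℝ) (j : Fin (K + 1)) (f : Fin N) :
    C.rate P j f = Real.log (1 + P j f * ‖C.h j j f‖ ^ 2 / C.interference P j f) := rfl

theorem interference_pos {P : Fin (K + 1) → Fin N → ℝ} (hP : ∀ i f, 0 ≤ P i f)
    (j : Fin (K + 1)) (f : Fin N) : 0 < C.interference P j f :=
  add_pos_of_nonneg_of_pos
    (Finset.sum_nonneg fun i _ => mul_nonneg (hP i f) (sq_nonneg _)) (C.noise_pos j f)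

theorem interference_update (P : Fin (K + 1) → Fin N → ℝ) (j : Fin (K + 1)) (p : Fin N → ℝ)
    (f : Fin N) : C.interference (Function.update P j p) j f = C.interference P j f := by
  unfold interference
  congr 1
  refine Finset.sum_congr rfl fun i hi => ?_
  rw [Function.update_of_ne (Finset.ne_of_mem_erase hi)]

theorem rate_update (P : Fin (K + 1) → Fin N → ℝ) (j : Fin (K + 1)) (p : Fin N → ℝ)
    (f : Fin N) : C.rate (Function.update P j p) j f =
      Real.log (1 + p f * (‖C.h j j f‖ ^ 2 / C.interference P j f)) := by
  rw [rate_eq, interference_update, Function.update_self, mul_div_assoc]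

theorem continuous_interference (j : Fin (K + 1)) (f : Fin N) :
    Continuous fun P => C.interference P j f := by
  unfold interference
  fun_prop

theorem isCompact_powerSet (j : Fin (K + 1)) : IsCompact (C.powerSet j) := by
  refine IsCompact.of_isClosed_subset (isCompact_Icc (a := 0) (b := fun _ => C.Pmax j)) ?_ ?_
  · have h : C.powerSet j = (⋂ f, {p | 0 ≤ p f}) ∩ {p | ∑ f, p f ≤ C.Pmax j} := by
      ext p; simp [powerSet]
    rw [h]
    exact (isClosed_iInter fun f => isClosed_le continuous_const (continuous_apply f)).inter
      (isClosed_le (by fun_prop) continuous_const)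
  · intro p hp
    exact ⟨hp.1, fun f =>
      (Finset.single_le_sum (fun g _ => hp.1 g) (Finset.mem_univ f)).trans hp.2⟩

theorem convex_powerSet (j : Fin (K + 1)) : Convex ℝ (C.powerSet j) := by
  intro p hp q hq a b ha hb hab
  refine ⟨fun f => add_nonneg (mul_nonneg ha (hp.1 f)) (mul_nonneg hb (hq.1 f)), ?_⟩
  simp only [Pi.add_apply, Pi.smul_apply, smul_eq_mul, Finset.sum_add_distrib, ← Finset.mul_sum]
  calc a * ∑ f, p f + b * ∑ f, q f ≤ a * C.Pmax j + b * C.Pmax j :=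
        add_le_add (mul_le_mul_of_nonneg_left hp.2 ha) (mul_le_mul_of_nonneg_left hq.2 hb)
    _ = C.Pmax j := by rw [← add_mul, hab, one_mul]

theorem zero_mem_powerSet (j : Fin (K + 1)) : (0 : Fin N → ℝ) ∈ C.powerSet j :=
  ⟨fun _ => le_rfl, by simpa using C.Pmax_nonneg j⟩

theorem cons_nonneg {P₁ : Fin N → ℝ} (hP₁ : P₁ ∈ C.powerSet 0) {P : Fin K → Fin N → ℝ}
    (hP : ∀ k, P k ∈ C.powerSet k.succ) (i : Fin (K + 1)) (f : Fin N) :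
    0 ≤ (Fin.cons P₁ P : Fin (K + 1) → Fin N → ℝ) i f := by
  refine Fin.cases ?_ (fun k => ?_) i
  · exact hP₁.1 f
  · exact (hP k).1 f

theorem continuousOn_utility {P₁ : Fin N → ℝ} (hP₁ : P₁ ∈ C.powerSet 0) (i : Fin K) :
    ContinuousOn ((C.subGame P₁).utility i) {P | ∀ k, P k ∈ C.powerSet k.succ} := by
  have hcons : Continuous fun P : Fin K → Fin N → ℝ =>
      (Fin.cons P₁ P : Fin (K + 1) → Fin N → ℝ) := by fun_prop
  change ContinuousOn (fun P : Fin K → Fin N → ℝ =>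
    ∑ f, C.rate (Fin.cons P₁ P : Fin (K + 1) → Fin N → ℝ) i.succ f) _
  refine continuousOn_finsetSum _ fun f _ => ?_
  have hpos : ∀ P ∈ {P : Fin K → Fin N → ℝ | ∀ k, P k ∈ C.powerSet k.succ},
      0 < C.interference (Fin.cons P₁ P) i.succ f :=
    fun P hP => C.interference_pos (C.cons_nonneg hP₁ hP) _ _
  refine ContinuousOn.log (continuousOn_const.add (ContinuousOn.div ?_ ?_ ?_)) ?_
  · exact Continuous.continuousOn (by fun_prop)
  · exact ((C.continuous_interference i.succ f).comp hcons).continuousOn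
  · exact fun P hP => (hpos P hP).ne'
  · intro P hP
    exact (add_pos_of_pos_of_nonneg one_pos (div_nonneg
      (mul_nonneg (C.cons_nonneg hP₁ hP _ _) (sq_nonneg _)) (hpos P hP).le)).ne'

theorem concaveOn_utility_update {P₁ : Fin N → ℝ} (hP₁ : P₁ ∈ C.powerSet 0) (i : Fin K)
    {P : Fin K → Fin N → ℝ} (hP : ∀ k, P k ∈ C.powerSet k.succ) :
    ConcaveOn ℝ (C.powerSet i.succ)
      (fun p => (C.subGame P₁).utility i (Function.update P i p)) := by
  refine ⟨C.convex_powerSet _, fun p hp q hq a b ha hb hab => ?_⟩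
  simp only [subGame, Fin.cons_update, rate_update, smul_eq_mul, Finset.mul_sum,
    ← Finset.sum_add_distrib]
  refine Finset.sum_le_sum fun f _ => ?_
  set c := ‖C.h i.succ i.succ f‖ ^ 2 / C.interference (Fin.cons P₁ P) i.succ f
  have hc : 0 ≤ c :=
    div_nonneg (sq_nonneg _) (C.interference_pos (C.cons_nonneg hP₁ hP) _ _).le
  have h := strictConcaveOn_log_Ioi.concaveOn.2
    (show 1 + p f * c ∈ Ioi (0 : ℝ) from
      add_pos_of_pos_of_nonneg one_pos (mul_nonneg (hp.1 f) hc))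
    (show 1 + q f * c ∈ Ioi (0 : ℝ) from
      add_pos_of_pos_of_nonneg one_pos (mul_nonneg (hq.1 f) hc)) ha hb hab
  simp only [smul_eq_mul] at h
  refine h.trans_eq (congrArg Real.log ?_)
  simp only [Pi.add_apply, Pi.smul_apply, smul_eq_mul]
  linear_combination hab

/-- The derivative of the rate of user `j` on sub-channel `f` with respect to its own power. -/
noncomputable def marginalRate (P : Fin (K + 1) → Fin N → ℝ) (j : Fin (K + 1)) (f : Fin N) : ℝ :=
  ‖C.h j j f‖ ^ 2 / (C.interference P j f + P j f * ‖C.h j j f‖ ^ 2)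

/-- Tangent-line bound of a concave function: `log z ≤ z - 1` for the ratio `z` of total received
powers after and before the deviation. -/
theorem rate_update_le {P : Fin (K + 1) → Fin N → ℝ} (hP : ∀ i f, 0 ≤ P i f)
    (j : Fin (K + 1)) {p : Fin N → ℝ} (hp : ∀ f, 0 ≤ p f) (f : Fin N) :
    C.rate (Function.update P j p) j f ≤
      C.rate P j f + C.marginalRate P j f * (p f - P j f) := by
  have hI := C.interference_pos hP j f
  rw [rate_update, rate_eq, marginalRate]
  set I := C.interference P j f
  set a := ‖C.h j j f‖ ^ 2
  have ha : 0 ≤ a := sq_nonneg _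
  have h1 : 0 < I + P j f * a := add_pos_of_pos_of_nonneg hI (mul_nonneg (hP j f) ha)
  have h2 : 0 < I + p f * a := add_pos_of_pos_of_nonneg hI (mul_nonneg (hp f) ha)
  have h3 : 1 + p f * (a / I) = (I + p f * a) / I := by field_simp
  have h4 : 1 + P j f * a / I = (I + P j f * a) / I := by field_simp
  have h5 := Real.log_le_sub_one_of_pos (div_pos h2 h1)
  rw [Real.log_div h2.ne' h1.ne'] at h5
  rw [h3, h4, Real.log_div h2.ne' hI.ne', Real.log_div h1.ne' hI.ne']
  have h6 : (I + p f * a) / (I + P j f * a) - 1 = a / (I + P j f * a) * (p f - P j f) := by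
    rw [div_sub_one h1.ne', div_mul_eq_mul_div]
    congr 1
    ring
  linarith

theorem exists_isPureNash {P₁ : Fin N → ℝ} (hP₁ : P₁ ∈ C.powerSet 0) :
    ∃ P : Fin K → Fin N → ℝ, (C.subGame P₁).IsPureNash P := by
  -- Profiles are flattened because the variational inequality needs an inner product.
  let profile : EuclideanSpace ℝ (Fin K × Fin N) → Fin K → Fin N → ℝ := fun x i f => x (i, f)
  let S : Set (EuclideanSpace ℝ (Fin K × Fin N)) := {x | ∀ k, profile x k ∈ C.powerSet k.succ}
  have hprofile : Continuous profile :=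
    continuous_pi fun i => continuous_pi fun f => by fun_prop
  have hcons : Continuous fun x => (Fin.cons P₁ (profile x) : Fin (K + 1) → Fin N → ℝ) := by
    fun_prop
  have hS : IsCompact S := by
    refine IsCompact.of_isClosed_subset ((EuclideanSpace.equiv (Fin K × Fin N) ℝ).toHomeomorph
      |>.isCompact_preimage.2 (isCompact_Icc (a := 0) (b := fun k => C.Pmax k.1.succ))) ?_ ?_
    · have h : S = ⋂ k, (fun x => profile x k) ⁻¹' C.powerSet k.succ := by
        ext x; simp [S]
      rw [h]
      exact isClosed_iInter fun k => (C.isCompact_powerSet _).isClosed.preimage (by fun_prop)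
    · intro x hx
      exact ⟨fun k => (hx k.1).1 k.2, fun k => (Finset.single_le_sum
        (fun g _ => (hx k.1).1 g) (Finset.mem_univ k.2)).trans (hx k.1).2⟩
  have hconv : Convex ℝ S := fun x hx y hy a b ha hb hab k =>
    C.convex_powerSet k.succ (hx k) (hy k) ha hb hab
  have hne : S.Nonempty := ⟨0, fun k => C.zero_mem_powerSet _⟩
  obtain ⟨x, hx, hvi⟩ := hS.exists_variational_inequality hconv hne
    (F := fun x => WithLp.toLp 2 fun k : Fin K × Fin N =>
      C.marginalRate (Fin.cons P₁ (profile x)) k.1.succ k.2) (by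
    refine (PiLp.continuous_toLp 2 _).comp_continuousOn (continuousOn_pi.2 fun k => ?_)
    refine ContinuousOn.div continuousOn_const ?_ ?_
    · exact (((C.continuous_interference _ _).comp hcons).add (by fun_prop)).continuousOn
    · intro x hx
      exact (add_pos_of_pos_of_nonneg (C.interference_pos (C.cons_nonneg hP₁ hx) _ _)
        (mul_nonneg (C.cons_nonneg hP₁ hx _ _) (sq_nonneg _))).ne')
  refine ⟨profile x, hx, fun i p hp => ?_⟩
  -- Testing against a unilateral deviation leaves only player `i`'s terms of the inner product.
  let y : EuclideanSpace ℝ (Fin K × Fin N) :=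
    WithLp.toLp 2 fun k => Function.update (profile x) i p k.1 k.2
  have hy : y ∈ S := by
    intro k
    change Function.update (profile x) i p k ∈ _
    rcases eq_or_ne k i with rfl | hk
    · rw [Function.update_self]; exact hp
    · rw [Function.update_of_ne hk]; exact hx k
  have h := hvi y hy
  have hsum : ∑ f, C.marginalRate (Fin.cons P₁ (profile x)) i.succ f *
      (p f - profile x i f) ≤ 0 := by
    refine Eq.trans_le ?_ h
    rw [PiLp.inner_apply, Fintype.sum_prod_type, Finset.sum_eq_single i]
    · refine Finset.sum_congr rfl fun f _ => ?_
      simp [y, profile, mul_comm]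
    · intro k _ hk
      refine Finset.sum_eq_zero fun f _ => ?_
      simp [y, profile, hk]
    · simp
  have hle : ∑ f, C.rate (Fin.cons P₁ (Function.update (profile x) i p)) i.succ f ≤
      ∑ f, (C.rate (Fin.cons P₁ (profile x)) i.succ f +
        C.marginalRate (Fin.cons P₁ (profile x)) i.succ f * (p f - profile x i f)) := by
    refine Finset.sum_le_sum fun f _ => ?_
    rw [Fin.cons_update]
    exact C.rate_update_le (C.cons_nonneg hP₁ hx) i.succ hp.1 f
  rw [Finset.sum_add_distrib] at hle
  exact hle.trans (add_le_of_nonpos_right hsum)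

end CRNetwork

theorem proposition1 {K N : ℕ} (C : CRNetwork K N) (P₁ : Fin N → ℝ) (hP₁ : P₁ ∈ C.powerSet 0) :
    (∀ i, IsCompact ((C.subGame P₁).strategies i) ∧
      Convex ℝ ((C.subGame P₁).strategies i) ∧
      ContinuousOn ((C.subGame P₁).utility i) {P | ∀ k, P k ∈ (C.subGame P₁).strategies k} ∧
      ∀ P : Fin K → Fin N → ℝ, (∀ k, P k ∈ (C.subGame P₁).strategies k) →
        QuasiconcaveOn ℝ ((C.subGame P₁).strategies i)
          (fun p => (C.subGame P₁).utility i (Function.update P i p))) ∧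
    ∃ P : Fin K → Fin N → ℝ, (C.subGame P₁).IsPureNash P :=
  ⟨fun i => ⟨C.isCompact_powerSet _, C.convex_powerSet _, C.continuousOn_utility hP₁ i,
    fun _ hP => (C.concaveOn_utility_update hP₁ i hP).quasiconcaveOn⟩, C.exists_isPureNash hP₁⟩
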